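/- Let $b$ be a prime, let $s \ge 2$ and $m \ge 1$ be integers, let $p \in \mathbb{Z}_b[x]$ be irreducible with $\deg(p) = m$, let $0 < \alpha \le 1$, and let $\boldsymbol{\gamma} = (\gamma_1,\dots,\gamma_s)$ be positive real weights. For an integer $k \ge 0$ with $b$-adic expansion $k = \kappa_0 + \kappa_1 b + \kappa_2 b^2 + \cdots$ put $\mathrm{tr}_m(k)(x) = \kappa_0 + \kappa_1 x + \cdots + \kappa_{m-1} x^{m-1} \in \mathbb{Z}_b[x]$. For $\boldsymbol{q} = (q_1,\dots,q_s) \in \mathbb{Z}_b[x]^s$ let $$\mathscr{D}_p(\boldsymbol{q}) = \{ \boldsymbol{k} \in \mathbb{N}_0^s : \mathrm{tr}_m(k_1) q_1 + \cdots + \mathrm{tr}_m(k_s) q_s \equiv 0 \pmod p \},$$ $$B(\boldsymbol{q},\alpha,\boldsymbol{\gamma}) = \sum_{\boldsymbol{k} \in \mathscr{D}_p(\boldsymbol{q}) \setminus \{\boldsymbol{0}\}} \ \prod_{j=1}^s r_{2\alpha+1,\gamma_j}(k_j),$$ where $r_{\tau,\gamma}(0) = 1$ and $r_{\tau,\gamma}(k)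 = \gamma \frac{b}{(b-1) b^{\tau a}}$ if $k > 0$ has exactly $a$ digits in base $b$. Let $R_{b,m}$ be the set of nonzero polynomials in $\mathbb{Z}_b[x]$ of degree less than $m$, and for $q \in R_{b,m}$ let $\psi(q) = (1,q,\dots,q^{s-1}) \pmod p$, each entry being reduced to its remainder modulo $p$. Let $q^* \in R_{b,m}$ be any minimiser of $q \mapsto B(\psi(q),\alpha,\boldsymbol{\gamma})$ over $R_{b,m}$. Then for every real $\lambda$ with $\frac{1}{2\alpha+1} < \lambda \le 1$, $$B(\psi(q^*),\alpha,\boldsymbol{\gamma}) \le \frac{s^{1/\lambda}}{(b^m-1)^{1/\lambda}} \prod_{j=1}^s \left( 1 + \gamma_j^\lambda C_{b,\alpha,\lambda} \right)^{1/\lambda},$$ where $$C_{b,\alpha,\lambda} = \max\left( \frac{1}{(b^{2\alpha}-1)^\lambda}, \ \frac{(b-1)^{1-\lambda}}{b^{2\alpha\lambda} - b^{1-\lambda}} \right) > 0.$$ -/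

import Mathlib

open scoped ENNReal

noncomputable section

namespace PolyLattice

/-- The polynomial `tr_m(k)(x) = k₀ + k₁ x + ⋯ + k_{m-1} x^{m-1}` over `ℤ_b` attached to the
`b`-adic expansion `k = k₀ + k₁ b + k₂ b² + ⋯`, truncated after `m` digits. -/
def trPoly (b m k : ℕ) : Polynomial (ZMod b) :=
  ∑ i ∈ Finset.range m, Polynomial.monomial i ((k / b ^ i % b : ℕ) : ZMod b)

/-- The dual polynomial lattice: all `k ∈ ℕ₀^s` with
`tr_m(k₁) q₁ + ⋯ + tr_m(k_s) q_s ≡ 0 (mod p)`. -/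
def dualLattice {b : ℕ} (m : ℕ) {s : ℕ} (p : Polynomial (ZMod b))
    (q : Fin s → Polynomial (ZMod b)) : Set (Fin s → ℕ) :=
  {k | p ∣ ∑ j, trPoly b m (k j) * q j}

/-- One-dimensional coefficient `r_{τ,γ}(k)`: it is `1` for `k = 0`, and `γ b / ((b-1) b^{τ a})`
for `k > 0`, where `a` is the number of base-`b` digits of `k`. -/
def rOne (b : ℕ) (τ γ : ℝ) (k : ℕ) : ℝ :=
  if k = 0 then 1
  else γ * ((b : ℝ) / (((b : ℝ) - 1) * (b : ℝ) ^ (τ * ((Nat.digits b k).length : ℝ))))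

/-- `r_{τ,γ}(k) = ∏_j r_{τ,γ_j}(k_j)`. -/
def rProd (b : ℕ) {s : ℕ} (τ : ℝ) (γ : Fin s → ℝ) (k : Fin s → ℕ) : ℝ :=
  ∏ j, rOne b τ (γ j) (k j)

/-- The quality criterion
`B(q, α, γ) = ∑_{k ∈ D_p(q) \ {0}} r_{2α+1,γ}(k)`, a sum of nonnegative terms,
taken in `[0, ∞]` so that no convergence is presupposed. -/
def B {b : ℕ} (m : ℕ) {s : ℕ} (p : Polynomial (ZMod b)) (q : Fin s → Polynomial (ZMod b))
    (α : ℝ) (γ : Fin s → ℝ) : ℝ≥0∞ :=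
  ∑' k : ↥(dualLattice m p q \ {0}), ENNReal.ofReal (rProd b (2 * α + 1) γ k)

/-- `R_{b,m}`: the nonzero polynomials over `ℤ_b` of degree less than `m`. -/
def R (b m : ℕ) : Set (Polynomial (ZMod b)) :=
  {q | q.degree < (m : WithBot ℕ) ∧ q ≠ 0}

/-- The Korobov generating vector `ψ(q) = (1, q, …, q^{s-1}) mod p`. -/
def psi {b : ℕ} [Fact b.Prime] (s : ℕ) (p q : Polynomial (ZMod b)) :
    Fin s → Polynomial (ZMod b) :=
  fun j => q ^ (j : ℕ) % p

/-- `q` is a possible output of the Korobov algorithm: it lies in `R_{b,m}` and minimises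
`q ↦ B(ψ(q), α, γ)` over `R_{b,m}`. -/
def IsKorobovMinimizer {b : ℕ} [Fact b.Prime] (m : ℕ) {s : ℕ} (p : Polynomial (ZMod b))
    (α : ℝ) (γ : Fin s → ℝ) (q : Polynomial (ZMod b)) : Prop :=
  q ∈ R b m ∧ ∀ q' ∈ R b m, B m p (psi s p q) α γ ≤ B m p (psi s p q') α γ

/-- `C_{b,α,λ} = max ( (b^{2α} - 1)^{-λ}, (b-1)^{1-λ} / (b^{2αλ} - b^{1-λ}) )`. -/
def constC (b : ℕ) (α l : ℝ) : ℝ :=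
  max (1 / ((b : ℝ) ^ (2 * α) - 1) ^ l)
    (((b : ℝ) - 1) ^ (1 - l) / ((b : ℝ) ^ (2 * α * l) - (b : ℝ) ^ (1 - l)))

end PolyLattice

end

open scoped ENNReal

namespace PolyLattice

open Polynomial

/-! The minimum is at most the mean, applied to `B ^ l` over the `b ^ m - 1` elements of `R b m`. As
`l ≤ 1`, the power `l` is subadditive and passes inside the series; exchanging sums then leaves, for
each `k ≠ 0`, the number of `q` whose dual lattice contains `k`. Modulo `p`, membership says that
`q` is a root of the polynomial with coefficients `tr_m(k_j)` over the field `AdjoinRoot p`. If some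
`k_j` is not divisible by `b ^ m`, this polynomial is nonzero of degree at most `s - 1`, so at most
`s - 1` values of `q` occur (`ncard_R_dualLattice_le`). Otherwise `k = b ^ m h` and every `q` may
count, but the decay of the weights absorbs the factor `b ^ m - 1` (`rProd_pow_mul_rpow_le`).
Together these give `(s - 1) + 1 = s` times the full weight series, which factors over coordinates
into geometric series (`tsum_rOne_rpow_le`). -/

/-! ### Series in `[0, ∞]`: subadditivity and factorisation. -/

theorem ennreal_tsum_rpow_le {ι : Type*} (f : ι → ℝ≥0∞) {l : ℝ} (h0 : 0 < l) (h1 : l ≤ 1) :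
    (∑' i, f i) ^ l ≤ ∑' i, f i ^ l := by
  classical
  have hfin : ∀ t : Finset ι, (∑ i ∈ t, f i) ^ l ≤ ∑ i ∈ t, f i ^ l := by
    intro t
    induction t using Finset.induction_on with
    | empty => simp [h0]
    | insert a t ha ih =>
      rw [Finset.sum_insert ha, Finset.sum_insert ha]
      exact (ENNReal.rpow_add_le_add_rpow _ _ h0.le h1).trans (by gcongr)
  rw [← ENNReal.le_rpow_inv_iff h0, ENNReal.tsum_eq_iSup_sum]
  refine iSup_le fun t => ?_
  rw [ENNReal.le_rpow_inv_iff h0]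
  exact (hfin t).trans (ENNReal.sum_le_tsum t)

theorem ennreal_tsum_pi_prod {ι : Type*} : ∀ {s : ℕ} (f : Fin s → ι → ℝ≥0∞),
    ∑' k : Fin s → ι, ∏ j, f j (k j) = ∏ j, ∑' i, f j i
  | 0, f => by simp
  | s + 1, f => by
    rw [← (Fin.consEquiv fun _ : Fin (s + 1) => ι).tsum_eq, ENNReal.tsum_prod', Fin.prod_univ_succ,
      ← ennreal_tsum_pi_prod, ← ENNReal.tsum_mul_right]
    refine tsum_congr fun i => ?_
    rw [← ENNReal.tsum_mul_left]
    refine tsum_congr fun k => ?_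
    simp [Fin.prod_univ_succ, Fin.consEquiv]

/-! ### One-dimensional weights and their geometric sums. -/

section weights

variable {b : ℕ} {τ γ l : ℝ}

theorem rOne_nonneg (hb : 1 < b) (hγ : 0 < γ) (k : ℕ) : 0 ≤ rOne b τ γ k := by
  have hb' : (1 : ℝ) < b := by exact_mod_cast hb
  unfold rOne
  split_ifs
  · norm_num
  · have : (0 : ℝ) < b - 1 := by linarith
    positivity

theorem rOne_rpow (hb : 1 < b) (hγ : 0 < γ) {k : ℕ} (hk : k ≠ 0) :
    rOne b τ γ k ^ l = γ ^ l * ((b : ℝ) / (b - 1)) ^ l *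
      ((b : ℝ) ^ (-(τ * l))) ^ (Nat.digits b k).length := by
  have hb' : (1 : ℝ) < b := by exact_mod_cast hb
  have h1 : (0 : ℝ) < b - 1 := by linarith
  rw [rOne, if_neg hk, mul_assoc, Real.mul_rpow hγ.le (by positivity), ← div_div,
    div_eq_mul_inv (_ / _), Real.mul_rpow (by positivity) (by positivity), ← Real.rpow_neg
    (by positivity), ← Real.rpow_mul (by positivity), ← Real.rpow_natCast, ← Real.rpow_mul
    (by positivity)]
  ring_nf

theorem rOne_pow_mul_rpow (hb : 1 < b) (hγ : 0 < γ) (m : ℕ) {h : ℕ} (hh : h ≠ 0) :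
    rOne b τ γ (b ^ m * h) ^ l = ((b : ℝ) ^ (-(τ * l))) ^ m * rOne b τ γ h ^ l := by
  have : b ^ m * h ≠ 0 := mul_ne_zero (by positivity) hh
  rw [rOne_rpow hb hγ this, rOne_rpow hb hγ hh,
    Nat.digits_base_pow_mul hb (Nat.pos_of_ne_zero hh)]
  simp [pow_add]
  ring

theorem rpow_neg_lt_inv (hb : 1 < b) (hτ : 1 < τ * l) : (b : ℝ) ^ (-(τ * l)) * b < 1 := by
  have hb' : (1 : ℝ) < b := by exact_mod_cast hb
  rw [← Real.rpow_add_one (by positivity)]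
  exact Real.rpow_lt_one_of_one_lt_of_neg hb' (by linarith)

/-- The `(b - 1) b ^ i` integers with exactly `i + 1` digits share one weight, so grouping by digit
count yields a geometric sum. -/
theorem sum_range_pow_rOne_rpow (hb : 1 < b) (hγ : 0 < γ) (n : ℕ) :
    ∑ k ∈ Finset.range (b ^ n), rOne b τ γ k ^ l = 1 + γ ^ l *
      (((b - 1) * ((b : ℝ) / (b - 1)) ^ l * (b : ℝ) ^ (-(τ * l))) *
        ∑ i ∈ Finset.range n, ((b : ℝ) ^ (-(τ * l)) * b) ^ i) := by
  induction n with
  | zero => simp [rOne]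
  | succ n ih =>
    have hle : b ^ n ≤ b ^ (n + 1) := Nat.pow_le_pow_right (by omega) (by omega)
    have hblock : ∑ k ∈ Finset.Ico (b ^ n) (b ^ (n + 1)), rOne b τ γ k ^ l =
        ∑ k ∈ Finset.Ico (b ^ n) (b ^ (n + 1)), γ ^ l * ((b : ℝ) / (b - 1)) ^ l *
          ((b : ℝ) ^ (-(τ * l))) ^ (n + 1) := by
      refine Finset.sum_congr rfl fun k hk => ?_
      rw [Finset.mem_Ico] at hk
      have hk0 : k ≠ 0 := by
        have : 0 < b ^ n := by positivity
        omega
      rw [rOne_rpow hb hγ hk0, Nat.length_digits b k hb hk0, Nat.log_eq_of_pow_le_of_lt_pow hk.1 hk.2]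
    rw [← Finset.sum_range_add_sum_Ico _ hle, ih, hblock, Finset.sum_const, Nat.card_Ico,
      Finset.sum_range_succ, nsmul_eq_mul, Nat.cast_sub hle]
    push_cast
    ring

theorem geometric_constant (hb : 1 < b) (α : ℝ) (hτ : 1 < (2 * α + 1) * l) :
    0 < ((b : ℝ) ^ (2 * α * l) - (b : ℝ) ^ (1 - l)) ∧
    ((b - 1) * ((b : ℝ) / (b - 1)) ^ l * (b : ℝ) ^ (-((2 * α + 1) * l))) /
        (1 - (b : ℝ) ^ (-((2 * α + 1) * l)) * b) =
      ((b : ℝ) - 1) ^ (1 - l) / ((b : ℝ) ^ (2 * α * l) - (b : ℝ) ^ (1 - l)) := by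
  have hb' : (1 : ℝ) < b := by exact_mod_cast hb
  have hb0 : (0 : ℝ) < b := by linarith
  have h1 : (0 : ℝ) < b - 1 := by linarith
  have hpos : 0 < ((b : ℝ) ^ (2 * α * l) - (b : ℝ) ^ (1 - l)) :=
    sub_pos.2 (Real.rpow_lt_rpow_of_exponent_lt hb' (by linarith))
  refine ⟨hpos, ?_⟩
  have hz := rpow_neg_lt_inv hb hτ
  rw [div_eq_div_iff (by linarith) hpos.ne', Real.div_rpow hb0.le h1.le, Real.rpow_sub h1,
    Real.rpow_sub hb0, Real.rpow_one, Real.rpow_one]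
  have hz' : (b : ℝ) ^ (2 * α * l) * (b : ℝ) ^ l * (b : ℝ) ^ (-((2 * α + 1) * l)) = 1 := by
    rw [← Real.rpow_add hb0, ← Real.rpow_add hb0]
    ring_nf
    simp
  have : (0 : ℝ) < (b : ℝ) ^ l := by positivity
  have : (0 : ℝ) < ((b : ℝ) - 1) ^ l := by positivity
  field_simp
  linear_combination hz'

theorem constC_pos (hb : 1 < b) {α : ℝ} (hα : 0 < α) (l : ℝ) : 0 < constC b α l := by
  have hb' : (1 : ℝ) < b := by exact_mod_cast hb
  have : (0 : ℝ) < (b : ℝ) ^ (2 * α) - 1 :=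
    sub_pos.2 (Real.one_lt_rpow hb' (by linarith))
  exact lt_max_of_lt_left (by positivity)

theorem tsum_rOne_rpow_le (hb : 1 < b) {α : ℝ} (hγ : 0 < γ) (hτ : 1 < (2 * α + 1) * l) :
    ∑' k, ENNReal.ofReal (rOne b (2 * α + 1) γ k ^ l) ≤
      ENNReal.ofReal (1 + γ ^ l * constC b α l) := by
  have hb' : (1 : ℝ) < b := by exact_mod_cast hb
  have h1 : (0 : ℝ) < b - 1 := by linarith
  rw [ENNReal.tsum_eq_iSup_nat' (tendsto_pow_atTop_atTop_of_one_lt hb)]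
  refine iSup_le fun n => ?_
  rw [← ENNReal.ofReal_sum_of_nonneg fun k _ => Real.rpow_nonneg (rOne_nonneg hb hγ k) l]
  refine ENNReal.ofReal_le_ofReal ?_
  rw [sum_range_pow_rOne_rpow hb hγ]
  gcongr
  -- Only the second entry of the maximum defining `constC` is needed.
  refine le_trans ?_ (le_max_right _ _)
  obtain ⟨-, h⟩ := geometric_constant hb α hτ
  have hz := rpow_neg_lt_inv hb hτ
  rw [← h, div_eq_mul_inv]
  refine mul_le_mul_of_nonneg_left ?_ (by positivity)
  rw [← tsum_geometric_of_lt_one (by positivity) hz]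
  exact (summable_geometric_of_lt_one (by positivity) hz).sum_le_tsum _ fun i _ => by positivity

end weights

/-! ### Truncated polynomials and root counting modulo `p`. -/

theorem pow_dvd_of_digits_eq_zero {b m k : ℕ} (h : ∀ i < m, k / b ^ i % b = 0) : b ^ m ∣ k := by
  induction m with
  | zero => simp
  | succ m ih =>
    obtain ⟨c, rfl⟩ := ih fun i hi => h i (by omega)
    rcases Nat.eq_zero_or_pos (b ^ m) with h0 | h0
    · simp [h0]
    have hm := h m (by omega)
    rw [Nat.mul_div_cancel_left _ h0] at hm
    rw [pow_succ]
    exact Nat.mul_dvd_mul_left _ (Nat.dvd_of_mod_eq_zero hm)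

theorem coeff_trPoly (b m k : ℕ) {i : ℕ} (hi : i < m) :
    (trPoly b m k).coeff i = ((k / b ^ i % b : ℕ) : ZMod b) := by
  simp [trPoly, finsetSum_coeff, coeff_monomial, hi]

theorem degree_trPoly_lt (b m k : ℕ) : (trPoly b m k).degree < m := by
  rw [← mem_degreeLT]
  refine Submodule.sum_mem _ fun i hi => ?_
  rw [mem_degreeLT]
  exact (degree_monomial_le _ _).trans_lt (by exact_mod_cast Finset.mem_range.1 hi)

theorem pow_dvd_of_trPoly_eq_zero {b m k : ℕ} (hb : 0 < b) (h : trPoly b m k = 0) :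
    b ^ m ∣ k := by
  refine pow_dvd_of_digits_eq_zero fun i hi => ?_
  have := coeff_trPoly b m k hi
  rw [h, coeff_zero, eq_comm, ZMod.natCast_eq_zero_iff] at this
  exact Nat.eq_zero_of_dvd_of_lt this (Nat.mod_lt _ hb)

theorem degreeLT_finite_card (b m : ℕ) [Fact b.Prime] :
    Finite (degreeLT (ZMod b) m) ∧ Nat.card (degreeLT (ZMod b) m) = b ^ m := by
  have e := (degreeLTEquiv (ZMod b) m).toEquiv
  exact ⟨Finite.of_equiv _ e.symm, by rw [Nat.card_congr e]; simp⟩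

theorem R_eq (b m : ℕ) : R b m = (degreeLT (ZMod b) m : Set (ZMod b)[X]) \ {0} := by
  ext q
  simp [R, mem_degreeLT]

theorem R_finite (b m : ℕ) [Fact b.Prime] : (R b m).Finite := by
  rw [R_eq]
  have := (degreeLT_finite_card b m).1
  exact (Set.toFinite (degreeLT (ZMod b) m : Set (ZMod b)[X])).sdiff

theorem R_ncard (b m : ℕ) [Fact b.Prime] : (R b m).ncard = b ^ m - 1 := by
  rw [R_eq, Set.ncard_sdiff_singleton_of_mem (by simp), ← (degreeLT_finite_card b m).2]
  rfl

theorem eq_of_mk_eq {b : ℕ} [Fact b.Prime] {p f g : (ZMod b)[X]}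
    (hf : f.degree < p.degree) (hg : g.degree < p.degree)
    (h : AdjoinRoot.mk p f = AdjoinRoot.mk p g) : f = g := by
  rw [AdjoinRoot.mk_eq_mk] at h
  exact sub_eq_zero.1 (eq_zero_of_dvd_of_degree_lt h
    ((degree_sub_le _ _).trans_lt (max_lt hf hg)))

theorem mem_dualLattice_psi_iff {b : ℕ} [Fact b.Prime] {m s : ℕ} {p q : (ZMod b)[X]}
    {k : Fin s → ℕ} :
    k ∈ dualLattice m p (psi s p q) ↔
      (∑ j, C (AdjoinRoot.mk p (trPoly b m (k j))) * X ^ (j : ℕ)).eval (AdjoinRoot.mk p q) = 0 := by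
  have hmod : ∀ f, AdjoinRoot.mk p (f % p) = AdjoinRoot.mk p f := fun f => by
    rw [AdjoinRoot.mk_eq_mk, ← dvd_neg, neg_sub]
    exact ⟨f / p, by rw [sub_eq_iff_eq_add, EuclideanDomain.div_add_mod]⟩
  simp only [dualLattice, Set.mem_ofPred_eq, psi]
  rw [← AdjoinRoot.mk_eq_zero]
  simp [eval_finsetSum, hmod]

theorem ncard_R_dualLattice_le {b : ℕ} [Fact b.Prime] {m s : ℕ} {p : (ZMod b)[X]}
    (hp : Irreducible p) (hdeg : p.natDegree = m) {k : Fin s → ℕ}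
    (hk : ¬ ∀ j, b ^ m ∣ k j) :
    {q ∈ R b m | k ∈ dualLattice m p (psi s p q)}.ncard ≤ s - 1 := by
  have : Fact (Irreducible p) := ⟨hp⟩
  have hdeg' : p.degree = m := by rw [degree_eq_natDegree hp.ne_zero, hdeg]
  push Not at hk
  obtain ⟨j₀, hj₀⟩ := hk
  set P : (AdjoinRoot p)[X] := ∑ j, C (AdjoinRoot.mk p (trPoly b m (k j))) * X ^ (j : ℕ) with hP
  -- Truncations have degree below `deg p`, so a nonzero one stays nonzero modulo `p`.
  have hP0 : P ≠ 0 := by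
    intro h0
    have hc : P.coeff j₀ = AdjoinRoot.mk p (trPoly b m (k j₀)) := by
      simp [hP, finsetSum_coeff, coeff_X_pow, Fin.val_inj]
    rw [h0, coeff_zero, ← map_zero (AdjoinRoot.mk p)] at hc
    refine hj₀ (pow_dvd_of_trPoly_eq_zero (Fact.out : b.Prime).pos (eq_of_mk_eq ?_ ?_ hc.symm))
    · rw [hdeg']; exact degree_trPoly_lt b m _
    · rw [hdeg']; simp
  have hPd : P.natDegree ≤ s - 1 := by
    refine natDegree_sum_le_of_forall_le _ _ fun j _ => (natDegree_C_mul_X_pow_le _ _).trans ?_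
    have := j.2
    omega
  classical
  calc {q ∈ R b m | k ∈ dualLattice m p (psi s p q)}.ncard
      ≤ (P.roots.toFinset : Set (AdjoinRoot p)).ncard := by
        refine Set.ncard_le_ncard_of_injOn (AdjoinRoot.mk p) ?_ ?_ (Finset.finite_toSet _)
        · rintro q ⟨-, hq⟩
          simpa [hP0] using mem_dualLattice_psi_iff.1 hq
        · rintro f hf g hg h
          exact eq_of_mk_eq (by rw [hdeg']; exact hf.1.1) (by rw [hdeg']; exact hg.1.1) h
    _ = P.roots.toFinset.card := Set.ncard_coe_finset _
    _ ≤ P.roots.card := Multiset.toFinset_card_le _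
    _ ≤ s - 1 := (card_roots' P).trans hPd

/-! ### Averaging over `R b m`. -/

section average

variable {b : ℕ} {s : ℕ} {τ l : ℝ} {γ : Fin s → ℝ}

theorem rProd_nonneg (hb : 1 < b) (hγ : ∀ j, 0 < γ j) (k : Fin s → ℕ) : 0 ≤ rProd b τ γ k :=
  Finset.prod_nonneg fun j _ => rOne_nonneg hb (hγ j) (k j)

theorem rProd_rpow (hb : 1 < b) (hγ : ∀ j, 0 < γ j) (k : Fin s → ℕ) :
    rProd b τ γ k ^ l = ∏ j, rOne b τ (γ j) (k j) ^ l :=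
  (Real.finsetProd_rpow _ _ (fun j _ => rOne_nonneg hb (hγ j) (k j)) l).symm

theorem tsum_rProd_rpow_le (hb : 1 < b) {α : ℝ} (hγ : ∀ j, 0 < γ j)
    (hτ : 1 < (2 * α + 1) * l) :
    ∑' k : Fin s → ℕ, ENNReal.ofReal (rProd b (2 * α + 1) γ k ^ l) ≤
      ∏ j, ENNReal.ofReal (1 + γ j ^ l * constC b α l) := by
  simp_rw [rProd_rpow hb hγ, ENNReal.ofReal_prod_of_nonneg
    fun j _ => Real.rpow_nonneg (rOne_nonneg hb (hγ j) _) l]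
  rw [ennreal_tsum_pi_prod fun j i => ENNReal.ofReal (rOne b (2 * α + 1) (γ j) i ^ l)]
  exact Finset.prod_le_prod' fun j _ => tsum_rOne_rpow_le hb (hγ j) hτ

/-- Each nonzero coordinate gains `m` digits, hence a factor `z ^ m` with `z = b ^ (-(τ * l))`. One
such coordinate suffices, because `z * b < 1`. -/
theorem rProd_pow_mul_rpow_le (hb : 1 < b) (hγ : ∀ j, 0 < γ j) (hτ : 1 < τ * l) (m : ℕ)
    {h : Fin s → ℕ} (hh : h ≠ 0) :
    ((b : ℝ) ^ m - 1) * rProd b τ γ (fun j => b ^ m * h j) ^ l ≤ rProd b τ γ h ^ l := by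
  have hb' : (1 : ℝ) < b := by exact_mod_cast hb
  have hz := rpow_neg_lt_inv hb hτ
  set z := (b : ℝ) ^ (-(τ * l)) with hzdef
  have hz0 : 0 < z := by positivity
  have hz1 : z ≤ 1 := by nlinarith
  have hn : ∀ j k, 0 ≤ rOne b τ (γ j) k ^ l :=
    fun j k => Real.rpow_nonneg (rOne_nonneg hb (hγ j) k) l
  have hle : ∀ j, rOne b τ (γ j) (b ^ m * h j) ^ l ≤ rOne b τ (γ j) (h j) ^ l := fun j => by
    by_cases hj : h j = 0
    · simp [hj]
    · rw [rOne_pow_mul_rpow hb (hγ j) m hj]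
      exact mul_le_of_le_one_left (hn j _) (pow_le_one₀ hz0.le hz1)
  obtain ⟨j₀, hj₀⟩ := Function.ne_iff.1 hh
  have key : rProd b τ γ (fun j => b ^ m * h j) ^ l ≤ z ^ m * rProd b τ γ h ^ l := by
    rw [rProd_rpow hb hγ, rProd_rpow hb hγ, ← Finset.mul_prod_erase _ _ (Finset.mem_univ j₀),
      ← Finset.mul_prod_erase _ _ (Finset.mem_univ j₀), rOne_pow_mul_rpow hb (hγ j₀) m hj₀,
      ← mul_assoc]
    refine mul_le_mul_of_nonneg_left (Finset.prod_le_prod (fun j _ => hn j _) fun j _ => hle j) ?_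
    exact mul_nonneg (by positivity) (hn _ _)
  have hbm : (0 : ℝ) ≤ (b : ℝ) ^ m - 1 := sub_nonneg.2 (one_le_pow₀ hb'.le)
  have hr := Real.rpow_nonneg (rProd_nonneg (τ := τ) hb hγ h) l
  calc _ ≤ ((b : ℝ) ^ m - 1) * (z ^ m * rProd b τ γ h ^ l) := by gcongr
    _ ≤ (b : ℝ) ^ m * (z ^ m * rProd b τ γ h ^ l) := by gcongr; linarith
    _ = (z * b) ^ m * rProd b τ γ h ^ l := by rw [mul_pow]; ring
    _ ≤ _ := mul_le_of_le_one_left hr (pow_le_one₀ (by positivity) hz.le)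

variable [Fact b.Prime]

theorem B_rpow_le {m : ℕ} {p : (ZMod b)[X]} {q : Fin s → (ZMod b)[X]} {α : ℝ}
    (hγ : ∀ j, 0 < γ j) (hl0 : 0 < l) (hl1 : l ≤ 1) :
    B m p q α γ ^ l ≤ ∑' k, (dualLattice m p q \ {0}).indicator
      (fun k => ENNReal.ofReal (rProd b (2 * α + 1) γ k ^ l)) k := by
  refine (ennreal_tsum_rpow_le _ hl0 hl1).trans ?_
  rw [← tsum_subtype]
  refine (tsum_congr fun k => ?_).le
  exact ENNReal.ofReal_rpow_of_nonneg (rProd_nonneg (Fact.out : b.Prime).one_lt hγ _) hl0.le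

theorem tsum_R_B_rpow_le {m : ℕ} {p : (ZMod b)[X]} (hp : Irreducible p)
    (hdeg : p.natDegree = m) {α : ℝ} (hγ : ∀ j, 0 < γ j) (hs : 1 ≤ s)
    (hl0 : 0 < l) (hl1 : l ≤ 1) (hτ : 1 < (2 * α + 1) * l) :
    ∑ q ∈ (R_finite b m).toFinset, B m p (psi s p q) α γ ^ l ≤
      s * ∑' k : Fin s → ℕ, ENNReal.ofReal (rProd b (2 * α + 1) γ k ^ l) := by
  classical
  have hb := (Fact.out : b.Prime).one_lt
  set F : (Fin s → ℕ) → ℝ≥0∞ := fun k => ENNReal.ofReal (rProd b (2 * α + 1) γ k ^ l) with hF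
  set M : Set (Fin s → ℕ) := {k | k ≠ 0 ∧ ∀ j, b ^ m ∣ k j} with hM
  have hcard : (R_finite b m).toFinset.card = b ^ m - 1 := by
    rw [← Set.ncard_eq_toFinset_card _ (R_finite b m), R_ncard]
  -- The count is at most `s - 1` off `M` and at most `b ^ m - 1` on `M`; adding the two bounds
  -- covers both cases.
  have hpt : ∀ k, ∑ q ∈ (R_finite b m).toFinset,
      (dualLattice m p (psi s p q) \ {0}).indicator F k ≤
        (s - 1 : ℕ) * F k + M.indicator (fun k => (b ^ m - 1 : ℕ) * F k) k := fun k => by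
    by_cases hk0 : k = 0
    · simp [hk0]
    have hsum : ∑ q ∈ (R_finite b m).toFinset,
        (dualLattice m p (psi s p q) \ {0}).indicator F k =
        ({q ∈ (R_finite b m).toFinset | k ∈ dualLattice m p (psi s p q)}.card : ℕ) * F k := by
      rw [← nsmul_eq_mul, ← Finset.sum_const, Finset.sum_filter]
      refine Finset.sum_congr rfl fun q _ => ?_
      simp [Set.indicator_apply, hk0]
    rw [hsum]
    by_cases hk : ∀ j, b ^ m ∣ k j
    · rw [Set.indicator_of_mem (show k ∈ M from ⟨hk0, hk⟩)]
      refine le_add_left ?_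
      gcongr
      rw [← hcard]
      exact Finset.card_filter_le _ _
    · refine le_add_right ?_
      gcongr
      refine le_trans (le_of_eq ?_) (ncard_R_dualLattice_le hp hdeg hk)
      rw [← Set.ncard_coe_finset]
      congr 1
      ext q
      simp
  have hmul : ∑' k, M.indicator (fun k => ((b ^ m - 1 : ℕ) : ℝ≥0∞) * F k) k ≤ ∑' k, F k := by
    have hbm : 0 < b ^ m := pow_pos (by omega) m
    have hinj : Function.Injective fun (h : Fin s → ℕ) j => b ^ m * h j := fun h h' e =>
      funext fun j => Nat.eq_of_mul_eq_mul_left hbm (congrFun e j)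
    -- Reindexing by `k = b ^ m h` turns the series over `M` into one bounded termwise by the full
    -- series.
    rw [← hinj.tsum_eq]
    · refine ENNReal.tsum_le_tsum fun h => ?_
      by_cases hh : h = 0
      · simp [hh, hM, funext_iff]
      · refine (Set.indicator_le_self _ _ _).trans ?_
        have := rProd_pow_mul_rpow_le hb hγ hτ m hh
        rw [← ENNReal.ofReal_natCast, hF, ← ENNReal.ofReal_mul (by positivity),
          Nat.cast_sub hbm]
        exact ENNReal.ofReal_le_ofReal (by simpa using this)
    · intro k hk
      have hkM : k ∈ M := Set.mem_of_indicator_ne_zero hk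
      choose h hh using hkM.2
      exact ⟨h, (funext hh).symm⟩
  calc _ ≤ ∑ q ∈ (R_finite b m).toFinset,
        ∑' k, (dualLattice m p (psi s p q) \ {0}).indicator F k :=
        Finset.sum_le_sum fun q _ => B_rpow_le hγ hl0 hl1
    _ = ∑' k, ∑ q ∈ (R_finite b m).toFinset,
        (dualLattice m p (psi s p q) \ {0}).indicator F k :=
        (Summable.tsum_finsetSum fun _ _ => ENNReal.summable).symm
    _ ≤ ∑' k, ((s - 1 : ℕ) * F k + M.indicator (fun k => ((b ^ m - 1 : ℕ) : ℝ≥0∞) * F k) k) :=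
        ENNReal.tsum_le_tsum hpt
    _ ≤ (s - 1 : ℕ) * ∑' k, F k + ∑' k, F k := by
        rw [ENNReal.tsum_add, ENNReal.tsum_mul_left]
        gcongr
    _ = s * ∑' k, F k := by
        rw [← add_one_mul]
        congr 1
        exact_mod_cast Nat.sub_add_cancel hs

end average

end PolyLattice

theorem theorem5p1 (b : ℕ) [Fact b.Prime] (s m : ℕ) (hs : 2 ≤ s) (hm : 1 ≤ m)
    (p : Polynomial (ZMod b)) (hp : Irreducible p) (hdeg : p.natDegree = m)
    (α : ℝ) (hα0 : 0 < α) (hα1 : α ≤ 1) (γ : Fin s → ℝ) (hγ : ∀ j, 0 < γ j)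
    (qstar : Polynomial (ZMod b)) (hq : PolyLattice.IsKorobovMinimizer m p α γ qstar)
    (l : ℝ) (hl0 : 1 / (2 * α + 1) < l) (hl1 : l ≤ 1) :
    0 < PolyLattice.constC b α l ∧
    PolyLattice.B m p (PolyLattice.psi s p qstar) α γ ≤
      ENNReal.ofReal
        ((s : ℝ) ^ (1 / l) / ((b : ℝ) ^ m - 1) ^ (1 / l) *
          ∏ j, (1 + (γ j) ^ l * PolyLattice.constC b α l) ^ (1 / l)) := by
  open PolyLattice in
  have hb := (Fact.out : b.Prime).one_lt
  have hb' : (1 : ℝ) < b := by exact_mod_cast hb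
  have hC := constC_pos hb hα0 l
  refine ⟨hC, ?_⟩
  have hl : 0 < l := lt_trans (by positivity) hl0
  have hτ : 1 < (2 * α + 1) * l := by
    rwa [div_lt_iff₀ (by positivity), mul_comm] at hl0
  have hbm : (0 : ℝ) < (b : ℝ) ^ m - 1 := sub_pos.2 (one_lt_pow₀ hb' (by omega))
  have hfac : ∀ j, 0 ≤ 1 + γ j ^ l * constC b α l := fun j => by
    have := hγ j
    positivity
  -- Minimum against mean, before taking the root of order `l`.
  have hmin : ENNReal.ofReal ((b : ℝ) ^ m - 1) * B m p (psi s p qstar) α γ ^ l ≤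
      ENNReal.ofReal (s * ∏ j, (1 + γ j ^ l * constC b α l)) := by
    calc _ = ∑ q ∈ (R_finite b m).toFinset, B m p (psi s p qstar) α γ ^ l := by
          rw [Finset.sum_const, ← Set.ncard_eq_toFinset_card _ (R_finite b m), R_ncard, nsmul_eq_mul,
            ← ENNReal.ofReal_natCast, Nat.cast_sub (Nat.one_le_pow _ _ (by omega))]
          simp
      _ ≤ ∑ q ∈ (R_finite b m).toFinset, B m p (psi s p q) α γ ^ l :=
          Finset.sum_le_sum fun q hqR =>
            ENNReal.rpow_le_rpow (hq.2 q ((R_finite b m).mem_toFinset.1 hqR)) hl.le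
      _ ≤ s * ∑' k : Fin s → ℕ, ENNReal.ofReal (rProd b (2 * α + 1) γ k ^ l) :=
          tsum_R_B_rpow_le hp hdeg hγ (by omega) hl hl1 hτ
      _ ≤ s * ∏ j, ENNReal.ofReal (1 + γ j ^ l * constC b α l) := by
          gcongr
          exact tsum_rProd_rpow_le hb hγ hτ
      _ = _ := by
          rw [ENNReal.ofReal_mul (by positivity), ENNReal.ofReal_natCast,
            ENNReal.ofReal_prod_of_nonneg fun j _ => hfac j]
  have hP : 0 ≤ ∏ j, (1 + γ j ^ l * constC b α l) := Finset.prod_nonneg fun j _ => hfac j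
  rw [Real.finsetProd_rpow _ _ fun j _ => hfac j, ← Real.div_rpow (by positivity) hbm.le,
    ← Real.mul_rpow (by positivity) hP, ← ENNReal.ofReal_rpow_of_nonneg (by positivity)
    (by positivity), one_div, ENNReal.le_rpow_inv_iff hl, div_mul_eq_mul_div,
    ENNReal.ofReal_div_of_pos hbm, ENNReal.le_div_iff_mul_le (Or.inl (ENNReal.ofReal_pos.2 hbm).ne')
    (Or.inl ENNReal.ofReal_ne_top), mul_comm]
  exact hmin
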